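/- Let $d\ge 0$ be an integer, let $0\le a<b<\infty$, let $h:[0,\infty)\to\mathbb{R}$ be of bounded variation on $[a,b]$, and let $r:[0,\infty)\to[0,\infty)$ be bounded and piecewise monotone on $[a,b]$ (that is, $[a,b]$ can be cut by finitely many points into pieces on whose interiors $r$ is nondecreasing or nonincreasing). Let $ID$ be the class of infinitely divisible probability measures on $\mathbb{R}^d$. For $\nu\in ID$ let $Y_\nu$ be a Lévy process (independent and stationary increments, $Y_\nu(0)=0$, càdlàg paths) with $\mathcal{L}(Y_\nu(1))=\nu$, and put $$I^{h,r}_{(a,b]}(\nu)=\mathcal{L}\Big(\int_{(a,b]}h(t)\,dY_\nu(r(t))\Big),$$ where the random integral is defined pathwise through integration by parts, $$\int_{(a,b]}h(t)\,dY_\nu(r(t)):=h(b)Y_\nu(r(b))-h(a)Y_\nu(r(a))-\int_{(a,b]}Y_\nu(r(t)-)\,dh(t),$$ with $Y_\nu(r(t)-)$ the left limit at $t$ of $s\mapsto Y_\nu(r(s))$ and with the last integral the limit, under refinement of partitions $a=t_0\le t_1\le\dots\le t_n=b$, of the sums $\sum_{j=1}^n Y_\nu(r(t_{j-1}))\,(h(t_j)-h(t_{j-1}))$.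 Let $\mathcal{D}^{h,r}_{(a,b]}$ be the domain of definition of the mapping $I^{h,r}_{(a,b]}$, i.e. the set of all $\nu\in ID$ for which the random integral exists almost surely and its law depends only on $\nu$. Then $\mathcal{D}^{h,r}_{(a,b]}$ is a nonempty subset of $ID$ that is closed in the topology of weak convergence of probability measures on $\mathbb{R}^d$, closed under convolution, closed under all dilations ($\nu\in\mathcal{D}^{h,r}_{(a,b]}$ and $u\in\mathbb{R}$ imply $T_u\nu\in\mathcal{D}^{h,r}_{(a,b]}$, where $T_u\nu$ is the image of $\nu$ under $x\mapsto ux$), and closed under convolution powers (if $\nu\in\mathcal{D}^{h,r}_{(a,b]}$ and $c>0$, then $\nu^{\ast c}$, the measure with Fourier transform $\exp(c\log\hat\nu)$, where $\log\hat\nu$ is the continuous logarithm vanishing at $0$, exists and belongs to $\mathcal{D}^{h,r}_{(a,b]}$). -/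

import Mathlib

open MeasureTheory ProbabilityTheory Set Filter Topology
open scoped NNReal

noncomputable section

/-! ### Convolution semigroups of infinitely divisible measures -/

/-- The space `ℝ^d` with its Euclidean structure. -/
abbrev Rd (d : ℕ) : Type := EuclideanSpace ℝ (Fin d)

/-- Convolution of probability measures. -/
def pconv {d : ℕ} (μ ν : ProbabilityMeasure (Rd d)) : ProbabilityMeasure (Rd d) :=
  ⟨Measure.conv (μ : Measure (Rd d)) (ν : Measure (Rd d)), inferInstance⟩

/-- The `n`-fold convolution `μ ∗ ⋯ ∗ μ` (the point mass at `0` for `n = 0`). -/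
def nconv {d : ℕ} (μ : ProbabilityMeasure (Rd d)) : ℕ → ProbabilityMeasure (Rd d)
  | 0 => ⟨Measure.dirac 0, inferInstance⟩
  | n + 1 => pconv (nconv μ n) μ

/-- The class `ID` of infinitely divisible probability measures on `ℝ^d`. -/
def ID (d : ℕ) : Set (ProbabilityMeasure (Rd d)) :=
  {ν | ∀ n : ℕ, 0 < n → ∃ μ : ProbabilityMeasure (Rd d), nconv μ n = ν}

/-- The dilation `T_u ν`, the image of `ν` under `x ↦ u x`. -/
def dilate {d : ℕ} (u : ℝ) (ν : ProbabilityMeasure (Rd d)) : ProbabilityMeasure (Rd d) :=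
  ν.map (f := fun x : Rd d => u • x) (measurable_const_smul u).aemeasurable

/-- `ρ` is the convolution power `ν^{∗c}`: writing `ν̂ = exp Φ` with the continuous logarithm `Φ`
normalised by `Φ 0 = 0`, one has `ρ̂ = exp (c Φ)`.
Such a `Φ`, and hence `ρ`, is unique if it exists. -/
def IsConvPower {d : ℕ} (ν : ProbabilityMeasure (Rd d)) (c : ℝ)
    (ρ : ProbabilityMeasure (Rd d)) : Prop :=
  ∃ Φ : Rd d → ℂ, Continuous Φ ∧ Φ 0 = 0 ∧
    (∀ y, charFun (ν : Measure (Rd d)) y = Complex.exp (Φ y)) ∧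
    (∀ y, charFun (ρ : Measure (Rd d)) y = Complex.exp ((c : ℂ) * Φ y))

/-- `K` is a closed convolution subsemigroup of `ID` which is closed under dilations and under
convolution powers. Closedness refers to the weak topology on all probability measures. -/
structure IsClosedConvSubsemigroup {d : ℕ} (K : Set (ProbabilityMeasure (Rd d))) : Prop where
  subset_ID : K ⊆ ID d
  nonempty : K.Nonempty
  isClosed : IsClosed K
  conv_mem : ∀ μ ∈ K, ∀ ν ∈ K, pconv μ ν ∈ K
  dilate_mem : ∀ u : ℝ, ∀ ν ∈ K, dilate u ν ∈ K
  convPower_mem : ∀ c : ℝ, 0 < c → ∀ ν ∈ K, ∃ ρ ∈ K, IsConvPower ν c ρ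

/-! ### Lévy processes -/

/-- A Lévy process on `[0, ∞)`: it starts from zero, has independent and stationary increments,
and its paths are right-continuous with finite left limits. -/
structure IsLevyProcess {d : ℕ} {Ω : Type} [MeasurableSpace Ω] (Y : ℝ≥0 → Ω → Rd d)
    (P : Measure Ω) : Prop where
  measurable : ∀ t, Measurable (Y t)
  zero : ∀ᵐ ω ∂P, Y 0 ω = 0
  indep : HasIndepIncrements Y P
  stationary : ∀ s t : ℝ≥0, P.map (fun ω => Y (s + t) ω - Y s ω) = P.map (fun ω => Y t ω - Y 0 ω)
  cadlag : ∀ᵐ ω ∂P, ∀ t : ℝ≥0, ContinuousWithinAt (fun s => Y s ω) (Ici t) t ∧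
    ∃ l : Rd d, Tendsto (fun s => Y s ω) (𝓝[<] t) (𝓝 l)

/-! ### Random integrals -/

/-- `J` is the Stieltjes integral `∫_{(a,b]} g(t-) dh(t)`: the limit, under refinement of the
partitions `a = t 0 ≤ t 1 ≤ ⋯ ≤ t n = b`, of the sums `∑ (h (t (i+1)) - h (t i)) g (t i)`.
(For `h` right-continuous of bounded variation and `g` with one-sided limits this is the
Lebesgue–Stieltjes integral of the left limits of `g` with respect to the signed measure `dh`.) -/
def HasStieltjesIntegral {d : ℕ} (g : ℝ≥0 → Rd d) (h : ℝ≥0 → ℝ) (a b : ℝ≥0) (J : Rd d) : Prop :=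
  ∀ ε : ℝ, 0 < ε → ∃ F : Finset ℝ≥0, (∀ x ∈ F, x ∈ Icc a b) ∧
    ∀ (n : ℕ) (t : ℕ → ℝ≥0), Monotone t → t 0 = a → t n = b → (∀ x ∈ F, ∃ i ≤ n, t i = x) →
      ‖(∑ i ∈ Finset.range n, (h (t (i + 1)) - h (t i)) • g (t i)) - J‖ < ε

/-- The random vector `X` is the random integral `∫_{(a,b]} h(t) dY(r(t))`, defined pathwise
through integration by parts as `h(b) Y(r(b)) - h(a) Y(r(a)) - ∫_{(a,b]} Y(r(t)-) dh(t)`, where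
`Y(r(t)-)` is the left limit at `t` of the path `t ↦ Y(r(t))`. -/
def IsRandomIntegral {d : ℕ} {Ω : Type} [MeasurableSpace Ω] (h : ℝ≥0 → ℝ) (r : ℝ≥0 → ℝ≥0)
    (a b : ℝ≥0) (Y : ℝ≥0 → Ω → Rd d) (P : Measure Ω) (X : Ω → Rd d) : Prop :=
  AEMeasurable X P ∧ ∀ᵐ ω ∂P, ∃ J : Rd d,
    HasStieltjesIntegral (fun t => Y (r t) ω) h a b J ∧
      X ω = h b • Y (r b) ω - h a • Y (r a) ω - J

/-- `I^{h,r}_{(a,b]}(ν)` is well defined and equal to `ρ`: whichever Lévy process `Y` with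
`𝓛(Y 1) = ν` is taken, `∫_{(a,b]} h(t) dY(r(t))` exists and its probability distribution
is `ρ`. -/
def IsRandomIntegralLaw {d : ℕ} (h : ℝ≥0 → ℝ) (r : ℝ≥0 → ℝ≥0) (a b : ℝ≥0)
    (ν ρ : ProbabilityMeasure (Rd d)) : Prop :=
  ∀ (Ω : Type) [MeasurableSpace Ω] (P : Measure Ω) [IsProbabilityMeasure P]
    (Y : ℝ≥0 → Ω → Rd d), IsLevyProcess Y P → P.map (Y 1) = (ν : Measure (Rd d)) →
      ∃ X : Ω → Rd d, IsRandomIntegral h r a b Y P X ∧ P.map X = (ρ : Measure (Rd d))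

/-- The domain of definition `𝓓^{h,r}_{(a,b]}` of the random integral mapping `I^{h,r}_{(a,b]}`:
the infinitely divisible measures `ν` on `ℝ^d` for which `I^{h,r}_{(a,b]}(ν)` is well defined. -/
def randomIntegralDomain (d : ℕ) (h : ℝ≥0 → ℝ) (r : ℝ≥0 → ℝ≥0) (a b : ℝ≥0) :
    Set (ProbabilityMeasure (Rd d)) :=
  {ν | ν ∈ ID d ∧ ∃ ρ : ProbabilityMeasure (Rd d), IsRandomIntegralLaw h r a b ν ρ}

/-- `r` is piecewise monotone on `[a, b]`: it is bounded there, and there are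
`a = t 0 ≤ t 1 ≤ ⋯ ≤ t n = b` such that `r` is nondecreasing or nonincreasing on each open
interval `(t i, t (i+1))`. (Boundedness is automatic if `r` is monotone on the closed
intervals.) -/
def PiecewiseMonotoneOn (r : ℝ≥0 → ℝ≥0) (a b : ℝ≥0) : Prop :=
  BddAbove (r '' Icc a b) ∧ ∃ (n : ℕ) (t : ℕ → ℝ≥0), Monotone t ∧ t 0 = a ∧ t n = b ∧
    ∀ i < n, MonotoneOn r (Ioo (t i) (t (i + 1))) ∨ AntitoneOn r (Ioo (t i) (t (i + 1)))

end

/-!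
The random integral is defined at every infinitely divisible measure, so its domain is all of `ID`
(`randomIntegralDomain_eq_ID`), and the claimed closure properties are those of `ID`.

*Existence.* A càdlàg path run through a piecewise monotone time change is bounded and has left
limits (`PiecewiseMonotoneOn.exists_leftLim_comp`). For a nondecreasing integrator `h`, the
Stieltjes sum over a partition is the Lebesgue integral, over the range of `h`, of a step function
(`integral_stieltjesStep`). Along partitions that exhaust a countable dense set containing the
discontinuities of `h`, these step functions converge pointwise and boundedly. Dominated
convergence gives one limit for all such sequences of partitions. Hence the whole net of sums
converges, and it does so along a sequence of partitions chosen independently of the path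
(`exists_partitions_tendsto_stieltjesIntegral`).

*Uniqueness of the law.* Because of this deterministic sequence, the law of the integral is a limit
of laws of linear combinations of finitely many values of the process. The finite-dimensional
distributions of a Lévy process are determined by its law at time `1`: the characteristic functions
at time `1 / n` are continuous `n`-th roots, equal to `1` at the origin, of a function without
zeros, and such roots are unique (`IsLevyProcess.map_finite_times_eq`).

*Closure properties of `ID`.* Tails of a convolution root are dominated by tails of the measure
(`tail_le_tail_nconv`), so convolution roots of a weakly convergent sequence are tight, and
Prokhorov's theorem gives `isClosed_ID`. The inequality `1 - |φ(2y)|² ≤ 4 (1 - |φ(y)|²)`, applied to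
the convolution roots, shows that the characteristic function of an infinitely divisible measure
has no zeros. It therefore has a continuous logarithm `Φ`. The functions `exp (c Φ)` are
characteristic functions for rational `c`, and for all `c > 0` by Lévy's continuity theorem.
-/

/-! ### Characteristic functions and convolution -/

lemma charFun_pconv {d : ℕ} (μ ν : ProbabilityMeasure (Rd d)) (y : Rd d) :
    charFun (pconv μ ν : Measure (Rd d)) y
      = charFun (μ : Measure (Rd d)) y * charFun (ν : Measure (Rd d)) y :=
  charFun_conv y

lemma charFun_nconv {d : ℕ} (μ : ProbabilityMeasure (Rd d)) (n : ℕ) (y : Rd d) :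
    charFun (nconv μ n : Measure (Rd d)) y = charFun (μ : Measure (Rd d)) y ^ n := by
  induction n with
  | zero => simp [nconv]
  | succ n ih => rw [nconv, charFun_pconv, ih, pow_succ]

lemma charFun_dilate {d : ℕ} (u : ℝ) (ν : ProbabilityMeasure (Rd d)) (y : Rd d) :
    charFun (dilate u ν : Measure (Rd d)) y = charFun (ν : Measure (Rd d)) (u • y) :=
  charFun_map_smul u y

lemma probabilityMeasure_ext_charFun {d : ℕ} {μ ν : ProbabilityMeasure (Rd d)}
    (h : ∀ y, charFun (μ : Measure (Rd d)) y = charFun (ν : Measure (Rd d)) y) : μ = ν :=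
  Subtype.ext (Measure.ext_of_charFun (μ := (μ : Measure (Rd d))) (ν := (ν : Measure (Rd d)))
    (funext h))

lemma continuous_charFun_probabilityMeasure {d : ℕ} (μ : ProbabilityMeasure (Rd d)) :
    Continuous (charFun (μ : Measure (Rd d))) := by
  fun_prop

lemma charFun_probabilityMeasure_zero {d : ℕ} (μ : ProbabilityMeasure (Rd d)) :
    charFun (μ : Measure (Rd d)) 0 = 1 := by
  simp

lemma mem_ID_iff {d : ℕ} {ν : ProbabilityMeasure (Rd d)} :
    ν ∈ ID d ↔ ∀ n : ℕ, 0 < n → ∃ μ : ProbabilityMeasure (Rd d),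
      ∀ y, charFun (μ : Measure (Rd d)) y ^ n = charFun (ν : Measure (Rd d)) y := by
  refine forall₂_congr fun n _ => exists_congr fun μ => ?_
  refine ⟨fun h y => by rw [← charFun_nconv, h],
    fun h => probabilityMeasure_ext_charFun fun y => by rw [charFun_nconv, h]⟩

lemma diracZero_mem_ID (d : ℕ) :
    (⟨Measure.dirac 0, inferInstance⟩ : ProbabilityMeasure (Rd d)) ∈ ID d :=
  mem_ID_iff.2 fun n _ => ⟨⟨Measure.dirac 0, inferInstance⟩, fun y => by simp⟩

lemma pconv_mem_ID {d : ℕ} {μ ν : ProbabilityMeasure (Rd d)} (hμ : μ ∈ ID d) (hν : ν ∈ ID d) :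
    pconv μ ν ∈ ID d := by
  rw [mem_ID_iff] at *
  intro n hn
  obtain ⟨μ', hμ'⟩ := hμ n hn
  obtain ⟨ν', hν'⟩ := hν n hn
  exact ⟨pconv μ' ν', fun y => by rw [charFun_pconv, charFun_pconv, mul_pow, hμ', hν']⟩

lemma dilate_mem_ID {d : ℕ} (u : ℝ) {ν : ProbabilityMeasure (Rd d)} (hν : ν ∈ ID d) :
    dilate u ν ∈ ID d := by
  rw [mem_ID_iff] at *
  intro n hn
  obtain ⟨ν', hν'⟩ := hν n hn
  exact ⟨dilate u ν', fun y => by rw [charFun_dilate, charFun_dilate, hν']⟩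

/-! ### Closedness of the class of infinitely divisible measures -/

lemma charFun_tendsto_of_tendsto {d : ℕ} {ν : ℕ → ProbabilityMeasure (Rd d)}
    {ν₀ : ProbabilityMeasure (Rd d)} (h : Tendsto ν atTop (𝓝 ν₀)) (y : Rd d) :
    Tendsto (fun k => charFun (ν k : Measure (Rd d)) y) atTop
      (𝓝 (charFun (ν₀ : Measure (Rd d)) y)) :=
  ProbabilityMeasure.tendsto_iff_tendsto_charFun.1 h y

/-- Prokhorov's theorem for sequences. -/
lemma exists_subseq_tendsto_of_isTight {d : ℕ} {μ : ℕ → ProbabilityMeasure (Rd d)}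
    (h : IsTightMeasureSet (range fun k => (μ k : Measure (Rd d)))) :
    ∃ (μ₀ : ProbabilityMeasure (Rd d)) (φ : ℕ → ℕ), StrictMono φ ∧
      Tendsto (μ ∘ φ) atTop (𝓝 μ₀) := by
  have hc : IsCompact (closure (range μ)) := by
    refine isCompact_closure_of_isTightMeasureSet (h.subset ?_)
    rintro _ ⟨_, ⟨k, rfl⟩, rfl⟩
    exact ⟨k, rfl⟩
  obtain ⟨μ₀, -, φ, hφ, hlim⟩ := hc.tendsto_subseq (x := μ)
    fun k => subset_closure (mem_range_self k)
  exact ⟨μ₀, φ, hφ, hlim⟩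

/-- A pointwise limit of characteristic functions that is continuous at `0` is a
characteristic function. -/
lemma exists_charFun_eq_of_tendsto {d : ℕ} {μ : ℕ → ProbabilityMeasure (Rd d)} {f : Rd d → ℂ}
    (hf : ContinuousAt f 0)
    (h : ∀ y, Tendsto (fun k => charFun (μ k : Measure (Rd d)) y) atTop (𝓝 (f y))) :
    ∃ μ₀ : ProbabilityMeasure (Rd d), ∀ y, charFun (μ₀ : Measure (Rd d)) y = f y := by
  obtain ⟨μ₀, φ, hφ, hlim⟩ :=
    exists_subseq_tendsto_of_isTight (isTightMeasureSet_of_tendsto_charFun hf h)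
  exact ⟨μ₀, fun y => tendsto_nhds_unique (charFun_tendsto_of_tendsto hlim y)
    ((h y).comp hφ.tendsto_atTop)⟩

/-- If `n` independent variables of law `μ` all exceed `r` in the direction `y`, then their sum
exceeds `n r`. -/
lemma halfspace_pow_le_nconv {d : ℕ} (μ : ProbabilityMeasure (Rd d)) (y : Rd d) {r : ℝ} (n : ℕ)
    (hn : 0 < n) :
    (μ : Measure (Rd d)) {x | r < inner ℝ y x} ^ n
      ≤ (nconv μ n : Measure (Rd d)) {x | n * r < inner ℝ y x} := by
  have hmeas (s : ℝ) : MeasurableSet {x : Rd d | s < inner ℝ y x} :=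
    measurableSet_lt measurable_const (by fun_prop)
  induction n, hn using Nat.le_induction with
  | base =>
    have : nconv μ 1 = μ := probabilityMeasure_ext_charFun fun y => by simp [charFun_nconv]
    simp [this]
  | succ n hn ih =>
    rw [nconv]
    change _ ≤ Measure.conv (nconv μ n : Measure (Rd d)) (μ : Measure (Rd d)) _
    rw [Measure.conv, Measure.map_apply (by fun_prop) (hmeas _)]
    calc _ ≤ (nconv μ n : Measure (Rd d)) {x | n * r < inner ℝ y x}
          * (μ : Measure (Rd d)) {x | r < inner ℝ y x} := by rw [pow_succ]; gcongr
      _ = ((nconv μ n : Measure (Rd d)).prod (μ : Measure (Rd d)))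
          ({x | n * r < inner ℝ y x} ×ˢ {x | r < inner ℝ y x}) := (Measure.prod_prod _ _).symm
      _ ≤ _ := by
        refine measure_mono fun p hp => ?_
        obtain ⟨h1, h2⟩ := hp
        simp only [mem_ofPred_eq, mem_preimage, inner_add_right] at *
        push_cast
        linarith

/-- The two-sided tail bound coming from `halfspace_pow_le_nconv`: tails of a convolution root are
controlled by tails of the measure itself. -/
lemma tail_le_tail_nconv {d : ℕ} (μ : ProbabilityMeasure (Rd d)) (y : Rd d) {r : ℝ} (hr : 0 ≤ r)
    (n : ℕ) (hn : 0 < n) :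
    (μ : Measure (Rd d)) {x | r < ‖inner ℝ y x‖}
      ≤ 2 * ((nconv μ n : Measure (Rd d)) {x | r < ‖inner ℝ y x‖}) ^ (1 / n : ℝ) := by
  have hn1 : (1 : ℝ) ≤ n := by exact_mod_cast hn
  have key (z : Rd d) (hz : z = y ∨ z = -y) : (μ : Measure (Rd d)) {x | r < inner ℝ z x}
      ≤ ((nconv μ n : Measure (Rd d)) {x | r < ‖inner ℝ y x‖}) ^ (1 / n : ℝ) := by
    rw [one_div, ENNReal.le_rpow_inv_iff (by positivity), ENNReal.rpow_natCast]
    refine (halfspace_pow_le_nconv μ z n hn).trans (measure_mono fun x hx => ?_)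
    simp only [mem_ofPred_eq] at *
    have h1 : r < inner ℝ z x := lt_of_le_of_lt (by nlinarith) hx
    refine h1.trans_le ?_
    rcases hz with rfl | rfl
    · exact le_abs_self _
    · rw [inner_neg_left]
      exact neg_le_abs _
  calc _ ≤ (μ : Measure (Rd d)) ({x | r < inner ℝ y x} ∪ {x | r < inner ℝ (-y) x}) := by
        refine measure_mono fun x hx => ?_
        simpa [lt_abs] using hx
    _ ≤ _ := measure_union_le _ _
    _ ≤ _ := by
      rw [two_mul]
      exact add_le_add (key y (.inl rfl)) (key (-y) (.inr rfl))

/-- Convolution roots of a tight sequence form a tight sequence. -/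
lemma isTight_of_isTight_nconv {d : ℕ} {μ : ℕ → ProbabilityMeasure (Rd d)} (n : ℕ) (hn : 0 < n)
    (h : IsTightMeasureSet (range fun k => (nconv (μ k) n : Measure (Rd d)))) :
    IsTightMeasureSet (range fun k => (μ k : Measure (Rd d))) := by
  rw [isTightMeasureSet_iff_inner_tendsto ℝ] at *
  intro y
  have hlim : Tendsto (fun r : ℝ => 2 * (⨆ k, (nconv (μ k) n : Measure (Rd d))
      {x | r < ‖inner ℝ y x‖}) ^ (1 / n : ℝ)) atTop (𝓝 0) := by
    have h1 := h y
    simp only [iSup_range] at h1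
    have hpos : (0 : ℝ) < 1 / n := by positivity
    have h2 := ENNReal.Tendsto.const_mul (a := 2)
      ((ENNReal.continuous_rpow_const (y := (1 / n : ℝ))).continuousAt.tendsto.comp h1)
      (.inr (by simp))
    rw [ENNReal.zero_rpow_of_pos hpos, mul_zero] at h2
    exact h2
  refine tendsto_of_tendsto_of_tendsto_of_le_of_le' tendsto_const_nhds hlim
    (Eventually.of_forall fun _ => zero_le) ?_
  filter_upwards [eventually_ge_atTop 0] with r hr
  simp only [iSup_range]
  refine iSup_le fun k => (tail_le_tail_nconv (μ k) y hr n hn).trans ?_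
  gcongr
  exact le_iSup (fun k => (nconv (μ k) n : Measure (Rd d)) {x | r < ‖inner ℝ y x‖}) k

lemma isClosed_ID (d : ℕ) : IsClosed (ID d) := by
  refine IsSeqClosed.isClosed fun ν ν₀ hν hlim => ?_
  simp only [mem_ID_iff] at hν ⊢
  intro n hn
  choose μ hμ using fun k => hν k n hn
  have htight : IsTightMeasureSet (range fun k => (nconv (μ k) n : Measure (Rd d))) :=
    isTightMeasureSet_of_tendsto_charFun (μ := fun k => (nconv (μ k) n : Measure (Rd d)))
      (continuous_charFun_probabilityMeasure ν₀).continuousAt fun y => by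
        simpa only [charFun_nconv, hμ] using charFun_tendsto_of_tendsto hlim y
  obtain ⟨μ₀, φ, hφ, hμ₀⟩ := exists_subseq_tendsto_of_isTight (isTight_of_isTight_nconv n hn htight)
  refine ⟨μ₀, fun y => tendsto_nhds_unique ((charFun_tendsto_of_tendsto hμ₀ y).pow n) ?_⟩
  simpa only [Function.comp_def, hμ] using
    (charFun_tendsto_of_tendsto hlim y).comp hφ.tendsto_atTop

/-! ### The characteristic function of an infinitely divisible measure has no zeros -/

/-- The doubling inequality, from `3 - 4 cos θ + cos 2θ = 2 (1 - cos θ)² ≥ 0`. -/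
lemma one_sub_re_charFun_two_smul_le {d : ℕ} (μ : ProbabilityMeasure (Rd d)) (y : Rd d) :
    1 - (charFun (μ : Measure (Rd d)) ((2 : ℝ) • y)).re
      ≤ 4 * (1 - (charFun (μ : Measure (Rd d)) y).re) := by
  have hre (z : Rd d) : (charFun (μ : Measure (Rd d)) z).re
      = ∫ x, Real.cos (inner ℝ x z) ∂(μ : Measure (Rd d)) := by
    rw [charFun_apply]
    have := integral_re (μ := (μ : Measure (Rd d))) (𝕜 := ℂ)
      (f := fun x => Complex.exp ((inner ℝ x z : ℝ) * Complex.I))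
      (Integrable.of_bound (by fun_prop) 1 (ae_of_all _ fun x => by
        rw [Complex.norm_exp_ofReal_mul_I]))
    simp only [RCLike.re_eq_complex_re] at this
    rw [← this]
    simp [Complex.exp_ofReal_mul_I_re]
  have hint (z : Rd d) : Integrable (fun x => Real.cos (inner ℝ x z)) (μ : Measure (Rd d)) :=
    Integrable.of_bound (by fun_prop) 1 (ae_of_all _ fun x => by
      simpa using Real.abs_cos_le_one _)
  have hnn : 0 ≤ ∫ x, (3 - 4 * Real.cos (inner ℝ x y) + Real.cos (inner ℝ x ((2 : ℝ) • y)))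
      ∂(μ : Measure (Rd d)) := by
    refine integral_nonneg fun x => ?_
    simp only [inner_smul_right, Real.cos_two_mul, Pi.zero_apply]
    nlinarith [sq_nonneg (1 - Real.cos (inner ℝ x y))]
  have hint4 := (hint y).const_mul 4
  have hint3 : Integrable (fun _ : Rd d => (3 : ℝ)) (μ : Measure (Rd d)) := integrable_const _
  rw [integral_add (f := fun x => 3 - 4 * Real.cos (inner ℝ x y)) (hint3.sub hint4) (hint _),
    integral_sub hint3 hint4, integral_const_mul] at hnn
  simp only [integral_const, probReal_univ, smul_eq_mul, one_mul] at hnn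
  rw [hre, hre]
  linarith

/-- The doubling inequality for the symmetrization of `μ`. -/
lemma one_sub_norm_charFun_sq_two_smul_le {d : ℕ} (μ : ProbabilityMeasure (Rd d)) (y : Rd d) :
    1 - ‖charFun (μ : Measure (Rd d)) ((2 : ℝ) • y)‖ ^ 2
      ≤ 4 * (1 - ‖charFun (μ : Measure (Rd d)) y‖ ^ 2) := by
  have h (z : Rd d) : (charFun (pconv μ (dilate (-1) μ) : Measure (Rd d)) z).re
      = ‖charFun (μ : Measure (Rd d)) z‖ ^ 2 := by
    rw [charFun_pconv, charFun_dilate, neg_one_smul, charFun_neg, Complex.mul_conj,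
      Complex.ofReal_re, Complex.normSq_eq_norm_sq]
  simpa only [h] using one_sub_re_charFun_two_smul_le (pconv μ (dilate (-1) μ)) y

lemma charFun_two_smul_ne_zero_of_mem_ID {d : ℕ} {ν : ProbabilityMeasure (Rd d)} (hν : ν ∈ ID d)
    {y : Rd d} (hy : charFun (ν : Measure (Rd d)) y ≠ 0) :
    charFun (ν : Measure (Rd d)) ((2 : ℝ) • y) ≠ 0 := by
  rw [mem_ID_iff] at hν
  intro h0
  -- a zero at `2y` forces the modulus of every convolution root at `y` away from `1`
  have hbound (n : ℕ) : ‖charFun (ν : Measure (Rd d)) y‖ ^ 2 ≤ (3 / 4 : ℝ) ^ (n + 1) := by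
    obtain ⟨μ, hμ⟩ := hν (n + 1) n.succ_pos
    have hz : charFun (μ : Measure (Rd d)) ((2 : ℝ) • y) = 0 :=
      pow_eq_zero_iff (n.succ_ne_zero) |>.1 ((hμ _).trans h0)
    have h1 := one_sub_norm_charFun_sq_two_smul_le μ y
    rw [hz] at h1
    rw [← hμ, norm_pow, ← pow_mul, mul_comm, pow_mul]
    refine pow_le_pow_left₀ (by positivity) ?_ _
    norm_num at h1
    linarith
  have hlim : Tendsto (fun n : ℕ => (3 / 4 : ℝ) ^ (n + 1)) atTop (𝓝 0) :=
    (tendsto_pow_atTop_nhds_zero_of_lt_one (by norm_num) (by norm_num)).comp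
      (tendsto_add_atTop_nat 1)
  have := ge_of_tendsto' hlim hbound
  exact hy (by simpa using le_antisymm this (by positivity))

/-- There are no zeros near the origin, and doubling carries this to all of space. -/
lemma charFun_ne_zero_of_mem_ID {d : ℕ} {ν : ProbabilityMeasure (Rd d)} (hν : ν ∈ ID d)
    (y : Rd d) : charFun (ν : Measure (Rd d)) y ≠ 0 := by
  have hlim : Tendsto (fun k : ℕ => charFun (ν : Measure (Rd d)) ((1 / 2 : ℝ) ^ k • y)) atTop
      (𝓝 (charFun (ν : Measure (Rd d)) ((0 : ℝ) • y))) :=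
    ((continuous_charFun_probabilityMeasure ν).tendsto _).comp
      ((tendsto_pow_atTop_nhds_zero_of_lt_one (by norm_num) (by norm_num)).smul_const y)
  rw [zero_smul, charFun_probabilityMeasure_zero] at hlim
  obtain ⟨k, hk⟩ := (hlim.eventually_ne one_ne_zero).exists
  induction k with
  | zero => simpa using hk
  | succ k ih =>
    refine ih ?_
    have := charFun_two_smul_ne_zero_of_mem_ID hν hk
    rwa [smul_smul, pow_succ, mul_comm, mul_assoc, show (1 / 2 : ℝ) * 2 = 1 by norm_num,
      mul_one] at this

/-! ### Convolution powers -/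

/-- Continuous `n`-th roots of a nonvanishing function on a connected space are determined by their
value at one point. -/
lemma eq_of_pow_eq_pow_of_continuous {X : Type*} [TopologicalSpace X] [PreconnectedSpace X]
    {f g : X → ℂ} (hf : Continuous f) (hg : Continuous g) (hg0 : ∀ x, g x ≠ 0) {n : ℕ}
    (hn : n ≠ 0) (h : ∀ x, f x ^ n = g x ^ n) {x₀ : X} (h0 : f x₀ = g x₀) (x : X) :
    f x = g x := by
  have hfin : {z : ℂ | z ^ n = 1}.Finite := by
    refine (Polynomial.nthRootsFinset n (1 : ℂ)).finite_toSet.subset fun z hz => ?_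
    simpa [Polynomial.mem_nthRootsFinset (Nat.pos_of_ne_zero hn)] using hz
  have hconst := isPreconnected_univ.constant_of_mapsTo hfin.isDiscrete
    (f := fun x => f x / g x) (hf.div hg hg0).continuousOn
    (fun x _ => by
      change (f x / g x) ^ n = 1
      rw [div_pow, h, div_self (pow_ne_zero _ (hg0 x))]) (mem_univ x) (mem_univ x₀)
  rwa [h0, div_self (hg0 x₀), div_eq_one_iff_eq (hg0 x)] at hconst

lemma exists_continuous_log {d : ℕ} {φ : Rd d → ℂ} (hφ : Continuous φ) (hφ0 : φ 0 = 1)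
    (hne : ∀ y, φ y ≠ 0) :
    ∃ Φ : Rd d → ℂ, Continuous Φ ∧ Φ 0 = 0 ∧ ∀ y, φ y = Complex.exp (Φ y) := by
  obtain ⟨F, ⟨hF0, hF⟩, -⟩ := Complex.isCoveringMapOn_exp.existsUnique_continuousMap_lifts
    (⟨φ, hφ⟩ : C(Rd d, ℂ)) (a₀ := 0) (e₀ := 0) (by simp [hφ0]) (by simpa using hne)
  exact ⟨F, F.continuous, hF0, fun y => (congrFun hF y).symm⟩

/-- `exp (c Φ)` is a characteristic function for rational `c`, hence, by the continuity theorem,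
for every `c ≥ 0`. -/
lemma exists_charFun_eq_exp_mul_log {d : ℕ} {ν : ProbabilityMeasure (Rd d)} (hν : ν ∈ ID d)
    {Φ : Rd d → ℂ} (hΦ : Continuous Φ) (hΦ0 : Φ 0 = 0)
    (hexp : ∀ y, charFun (ν : Measure (Rd d)) y = Complex.exp (Φ y)) {c : ℝ} (hc : 0 ≤ c) :
    ∃ ρ : ProbabilityMeasure (Rd d),
      ∀ y, charFun (ρ : Measure (Rd d)) y = Complex.exp ((c : ℂ) * Φ y) := by
  rw [mem_ID_iff] at hν
  have hroot (n : ℕ) : ∃ μ : ProbabilityMeasure (Rd d),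
      ∀ y, charFun (μ : Measure (Rd d)) y = Complex.exp (Φ y / (n + 1 : ℕ)) := by
    obtain ⟨μ, hμ⟩ := hν (n + 1) n.succ_pos
    refine ⟨μ, eq_of_pow_eq_pow_of_continuous (continuous_charFun_probabilityMeasure μ)
      (by fun_prop) (fun y => Complex.exp_ne_zero _) n.succ_ne_zero (fun y => ?_) (x₀ := 0) ?_⟩
    · rw [hμ, hexp, ← Complex.exp_nat_mul, mul_div_cancel₀]
      exact_mod_cast n.succ_ne_zero
    · rw [charFun_probabilityMeasure_zero, hΦ0, zero_div, Complex.exp_zero]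
  choose μ hμ using hroot
  refine exists_charFun_eq_of_tendsto
    (μ := fun n => nconv (μ n) ⌊c * ((n + 1 : ℕ) : ℝ)⌋₊) (by fun_prop) fun y => ?_
  have hfloor : Tendsto (fun n : ℕ => (⌊c * ((n + 1 : ℕ) : ℝ)⌋₊ : ℝ) / ((n + 1 : ℕ) : ℝ)) atTop
      (𝓝 c) :=
    (tendsto_nat_floor_mul_div_atTop hc).comp
      (tendsto_natCast_atTop_atTop.comp (tendsto_add_atTop_nat 1))
  have hlim := (Complex.continuous_exp.tendsto _).comp
    (((Complex.continuous_ofReal.tendsto c).comp hfloor).mul_const (Φ y))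
  refine hlim.congr fun n => ?_
  rw [charFun_nconv, hμ, ← Complex.exp_nat_mul]
  simp only [Function.comp_apply]
  congr 1
  push_cast
  ring

lemma exists_isConvPower_of_mem_ID {d : ℕ} {c : ℝ} (hc : 0 < c) {ν : ProbabilityMeasure (Rd d)}
    (hν : ν ∈ ID d) : ∃ ρ ∈ ID d, IsConvPower ν c ρ := by
  obtain ⟨Φ, hΦ, hΦ0, hexp⟩ := exists_continuous_log (continuous_charFun_probabilityMeasure ν)
    (charFun_probabilityMeasure_zero ν) (charFun_ne_zero_of_mem_ID hν)
  obtain ⟨ρ, hρ⟩ := exists_charFun_eq_exp_mul_log hν hΦ hΦ0 hexp hc.le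
  refine ⟨ρ, mem_ID_iff.2 fun n hn => ?_, Φ, hΦ, hΦ0, hexp, hρ⟩
  obtain ⟨μ, hμ⟩ := exists_charFun_eq_exp_mul_log hν hΦ hΦ0 hexp
    (show 0 ≤ c / n from div_nonneg hc.le n.cast_nonneg)
  refine ⟨μ, fun y => ?_⟩
  rw [hμ, hρ, ← Complex.exp_nat_mul]
  congr 1
  have : (n : ℂ) ≠ 0 := by exact_mod_cast hn.ne'
  push_cast
  field_simp

/-! ### The law of a Lévy process is determined by its law at time one -/

lemma tendsto_charFun_map_of_ae_tendsto {d : ℕ} {Ω : Type} [MeasurableSpace Ω] {P : Measure Ω}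
    [IsProbabilityMeasure P] {X : ℕ → Ω → Rd d} {X₀ : Ω → Rd d} (hX : ∀ k, AEMeasurable (X k) P)
    (hX₀ : AEMeasurable X₀ P) (hlim : ∀ᵐ ω ∂P, Tendsto (fun k => X k ω) atTop (𝓝 (X₀ ω)))
    (y : Rd d) :
    Tendsto (fun k => charFun (P.map (X k)) y) atTop (𝓝 (charFun (P.map X₀) y)) := by
  have hint {Z : Ω → Rd d} (hZ : AEMeasurable Z P) : charFun (P.map Z) y
      = ∫ ω, Complex.exp ((inner ℝ (Z ω) y : ℝ) * Complex.I) ∂P := by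
    rw [charFun_apply, integral_map hZ (by fun_prop)]
  have hcont : Continuous fun x : Rd d => Complex.exp ((inner ℝ x y : ℝ) * Complex.I) := by
    fun_prop
  simp only [hint (hX _), hint hX₀]
  refine tendsto_integral_of_dominated_convergence (fun _ => 1)
    (fun k => (hcont.measurable.comp_aemeasurable (hX k)).aestronglyMeasurable)
    (integrable_const _) (fun k => ae_of_all _ fun ω => (Complex.norm_exp_ofReal_mul_I _).le) ?_
  filter_upwards [hlim] with ω hω
  exact (hcont.tendsto _).comp hω

namespace IsLevyProcess

variable {d : ℕ} {Ω Ω' : Type} [MeasurableSpace Ω] [MeasurableSpace Ω'] {P : Measure Ω}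
  {P' : Measure Ω'} {Y : ℝ≥0 → Ω → Rd d} {Y' : ℝ≥0 → Ω' → Rd d}

lemma map_increment (hY : IsLevyProcess Y P) {s t : ℝ≥0} (hst : s ≤ t) :
    P.map (fun ω => Y t ω - Y s ω) = P.map (Y (t - s)) := by
  have h := hY.stationary s (t - s)
  rw [add_tsub_cancel_of_le hst] at h
  rw [h]
  refine Measure.map_congr ?_
  filter_upwards [hY.zero] with ω hω
  rw [hω, sub_zero]

lemma charFun_map_add [IsProbabilityMeasure P] (hY : IsLevyProcess Y P) (s t : ℝ≥0) (y : Rd d) :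
    charFun (P.map (Y (s + t))) y = charFun (P.map (Y s)) y * charFun (P.map (Y t)) y := by
  have hind := hY.indep.indepFun_eval_sub (zero_le : 0 ≤ s) (le_self_add : s ≤ s + t) hY.zero
  have h := congrFun (hind.charFun_map_fun_add_eq_mul (hY.measurable s).aemeasurable
    ((hY.measurable _).sub (hY.measurable s)).aemeasurable) y
  have hinc := hY.map_increment (le_self_add : s ≤ s + t)
  rw [add_tsub_cancel_left] at hinc
  have heq : (Y (s + t) - Y s) = fun ω => Y (s + t) ω - Y s ω := rfl
  simp only [Pi.sub_apply, add_sub_cancel, Pi.mul_apply, heq, hinc] at h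
  exact h

lemma charFun_map_zero [IsProbabilityMeasure P] (hY : IsLevyProcess Y P) (y : Rd d) :
    charFun (P.map (Y 0)) y = 1 := by
  have : P.map (Y 0) = P.map (fun _ => (0 : Rd d)) := Measure.map_congr hY.zero
  simp [this, Measure.map_const]

lemma charFun_map_natCast_mul [IsProbabilityMeasure P] (hY : IsLevyProcess Y P) (n : ℕ) (t : ℝ≥0)
    (y : Rd d) : charFun (P.map (Y (n * t))) y = charFun (P.map (Y t)) y ^ n := by
  induction n with
  | zero => simpa using hY.charFun_map_zero y
  | succ n ih => rw [Nat.cast_succ, add_mul, one_mul, hY.charFun_map_add, ih, pow_succ]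

lemma charFun_map_tendsto [IsProbabilityMeasure P] (hY : IsLevyProcess Y P) {u : ℕ → ℝ≥0}
    {t : ℝ≥0} (hu : Tendsto u atTop (𝓝 t)) (hut : ∀ k, t ≤ u k) (y : Rd d) :
    Tendsto (fun k => charFun (P.map (Y (u k))) y) atTop (𝓝 (charFun (P.map (Y t)) y)) := by
  refine tendsto_charFun_map_of_ae_tendsto (fun k => (hY.measurable _).aemeasurable)
    (hY.measurable t).aemeasurable ?_ y
  filter_upwards [hY.cadlag] with ω hω
  exact (hω t).1.tendsto.comp (tendsto_nhdsWithin_iff.2 ⟨hu, Eventually.of_forall hut⟩)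

/-- The laws at the times `1 / n` agree as continuous roots of the same function, those at rational
times are powers of these, and right-continuity gives the remaining times. -/
lemma map_eq_of_map_one_eq [IsProbabilityMeasure P] [IsProbabilityMeasure P']
    (hY : IsLevyProcess Y P) (hY' : IsLevyProcess Y' P')
    (hne : ∀ y, charFun (P.map (Y 1)) y ≠ 0) (h1 : P.map (Y 1) = P'.map (Y' 1)) (t : ℝ≥0) :
    P.map (Y t) = P'.map (Y' t) := by
  have (s : ℝ≥0) : IsProbabilityMeasure (P.map (Y s)) :=
    Measure.isProbabilityMeasure_map (hY.measurable s).aemeasurable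
  have (s : ℝ≥0) : IsProbabilityMeasure (P'.map (Y' s)) :=
    Measure.isProbabilityMeasure_map (hY'.measurable s).aemeasurable
  have hinv (n : ℕ) : ((n + 1 : ℕ) : ℝ≥0) * ((n + 1 : ℕ) : ℝ≥0)⁻¹ = 1 :=
    mul_inv_cancel₀ (by exact_mod_cast n.succ_ne_zero)
  have hroot (n : ℕ) (y : Rd d) : charFun (P.map (Y ((n + 1 : ℕ) : ℝ≥0)⁻¹)) y
      = charFun (P'.map (Y' ((n + 1 : ℕ) : ℝ≥0)⁻¹)) y := by
    have hp := hY.charFun_map_natCast_mul (n + 1) ((n + 1 : ℕ) : ℝ≥0)⁻¹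
    have hp' := hY'.charFun_map_natCast_mul (n + 1) ((n + 1 : ℕ) : ℝ≥0)⁻¹
    rw [hinv] at hp hp'
    refine (eq_of_pow_eq_pow_of_continuous (by fun_prop) (by fun_prop) (fun y h0 => hne y ?_)
      n.succ_ne_zero (fun y => ?_) (x₀ := 0) (by simp) y).symm
    · rw [hp, h0, zero_pow n.succ_ne_zero]
    · rw [← hp, ← hp', h1]
  refine Measure.ext_of_charFun (funext fun y => ?_)
  set u : ℕ → ℝ≥0 := fun n => ⌈t * ((n + 1 : ℕ) : ℝ≥0)⌉₊ * ((n + 1 : ℕ) : ℝ≥0)⁻¹ with hu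
  have hut (n : ℕ) : t ≤ u n := by
    calc t = t * (((n + 1 : ℕ) : ℝ≥0) * ((n + 1 : ℕ) : ℝ≥0)⁻¹) := by rw [hinv, mul_one]
      _ ≤ u n := by
        rw [← mul_assoc]
        exact mul_le_mul_left (Nat.le_ceil _) _
  have hlim : Tendsto u atTop (𝓝 t) := by
    rw [← NNReal.tendsto_coe]
    have h := (tendsto_nat_ceil_mul_div_atTop (R := ℝ) t.2).comp
      (tendsto_natCast_atTop_atTop.comp (tendsto_add_atTop_nat 1))
    refine h.congr fun n => ?_
    have hceil : ⌈t * ((n + 1 : ℕ) : ℝ≥0)⌉₊ = ⌈(t : ℝ) * ((n + 1 : ℕ) : ℝ)⌉₊ := by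
      refine eq_of_forall_ge_iff fun m => ?_
      rw [Nat.ceil_le, Nat.ceil_le, ← NNReal.coe_le_coe]
      push_cast
      rfl
    simp only [hu, hceil, NNReal.coe_mul, NNReal.coe_natCast, NNReal.coe_inv, div_eq_mul_inv,
      Function.comp_apply]
    rfl
  refine tendsto_nhds_unique (hY.charFun_map_tendsto hlim hut y) ?_
  simpa only [hu, charFun_map_natCast_mul hY, charFun_map_natCast_mul hY', hroot] using
    hY'.charFun_map_tendsto hlim hut y

end IsLevyProcess

lemma sub_eq_sum_increments_fin {E : Type*} [AddCommGroup E] {n : ℕ} (f : Fin (n + 1) → E)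
    (i : Fin (n + 1)) :
    f i - f 0 = ∑ j : Fin n with j.castSucc < i, (f j.succ - f j.castSucc) := by
  induction i using Fin.induction with
  | zero => simp
  | succ i ih =>
    have : (Finset.univ.filter fun j : Fin n => j.castSucc < i.succ)
        = insert i (Finset.univ.filter fun j : Fin n => j.castSucc < i.castSucc) := by
      ext j
      simp only [Finset.mem_filter_univ, Finset.mem_insert, Fin.castSucc_lt_castSucc_iff,
        Fin.castSucc_lt_succ_iff, le_iff_eq_or_lt]
    rw [this, Finset.sum_insert (by simp), ← ih]
    abel

namespace IsLevyProcess

variable {d : ℕ} {Ω Ω' : Type} [MeasurableSpace Ω] [MeasurableSpace Ω'] {P : Measure Ω}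
  {P' : Measure Ω'} {Y : ℝ≥0 → Ω → Rd d} {Y' : ℝ≥0 → Ω' → Rd d}

/-- The values at ordered times are the image of the independent increments under a fixed linear
map. -/
lemma map_ordered_times [IsProbabilityMeasure P] (hY : IsLevyProcess Y P) {n : ℕ}
    {u : Fin (n + 1) → ℝ≥0} (hu : Monotone u) (hu0 : u 0 = 0) :
    P.map (fun ω i => Y (u i) ω)
      = (Measure.pi fun j : Fin n => P.map (Y (u j.succ - u j.castSucc))).map
          (fun x (i : Fin (n + 1)) => ∑ j : Fin n with j.castSucc < i, x j) := by
  have hm (s : ℝ≥0) := hY.measurable s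
  have hpi := (iIndepFun_iff_map_fun_eq_pi_map (fun j : Fin n =>
    ((hm (u j.succ)).sub (hm (u j.castSucc))).aemeasurable)).1 (hY.indep n u hu)
  have hinc (j : Fin n) : P.map (Y (u j.succ - u j.castSucc))
      = P.map (fun ω => Y (u j.succ) ω - Y (u j.castSucc) ω) :=
    (hY.map_increment (hu j.castSucc_le_succ)).symm
  simp only [hinc]
  change _ = (Measure.pi fun i : Fin n =>
    P.map (Y (u i.succ) - Y (u i.castSucc))).map _
  rw [← hpi, Measure.map_map (by fun_prop) (by fun_prop)]
  refine Measure.map_congr ?_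
  filter_upwards [hY.zero] with ω hω
  funext i
  have := sub_eq_sum_increments_fin (fun i => Y (u i) ω) i
  rw [hu0, hω, sub_zero] at this
  exact this

/-- The finite-dimensional distributions of a Lévy process are determined by the law at time `1`. -/
lemma map_finite_times_eq [IsProbabilityMeasure P] [IsProbabilityMeasure P']
    (hY : IsLevyProcess Y P) (hY' : IsLevyProcess Y' P')
    (hne : ∀ y, charFun (P.map (Y 1)) y ≠ 0) (h1 : P.map (Y 1) = P'.map (Y' 1))
    {n : ℕ} (s : Fin n → ℝ≥0) :
    P.map (fun ω i => Y (s i) ω) = P'.map (fun ω i => Y' (s i) ω) := by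
  set π := Tuple.sort s
  set u : Fin (n + 1) → ℝ≥0 := Fin.cons 0 (s ∘ π) with hu
  have hmono : Monotone u := by
    refine Fin.monotone_iff_le_succ.2 fun i => ?_
    cases n with
    | zero => exact i.elim0
    | succ n =>
      cases i using Fin.cases with
      | zero => simp [hu]
      | succ i =>
        rw [← Fin.succ_castSucc]
        simp only [hu, Fin.cons_succ]
        exact Tuple.monotone_sort s i.castSucc_le_succ
  have hs (i : Fin n) : s i = u (π.symm i).succ := by simp [hu]
  have hm (s : ℝ≥0) := hY.measurable s
  have hm' (s : ℝ≥0) := hY'.measurable s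
  have key : P.map (fun ω i => Y (u i) ω) = P'.map (fun ω i => Y' (u i) ω) := by
    rw [hY.map_ordered_times hmono rfl, hY'.map_ordered_times hmono rfl]
    simp only [hY.map_eq_of_map_one_eq hY' hne h1]
  have key2 := congrArg
    (Measure.map fun (x : Fin (n + 1) → Rd d) (i : Fin n) => x (π.symm i).succ) key
  rw [Measure.map_map (by fun_prop) (by fun_prop), Measure.map_map (by fun_prop) (by fun_prop)]
    at key2
  simpa only [Function.comp_def, ← hs] using key2

end IsLevyProcess

/-! ### Pathwise Stieltjes integrals -/

/-- `t 0 ≤ t 1 ≤ ⋯ ≤ t n` is a partition of `[a, b]`. -/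
structure IsPartition (a b : ℝ≥0) (n : ℕ) (t : ℕ → ℝ≥0) : Prop where
  monotone : Monotone t
  left : t 0 = a
  right : t n = b

/-- The left-endpoint Stieltjes sum of `g` with respect to `h`. -/
noncomputable def stieltjesSum {E : Type*} [AddCommGroup E] [Module ℝ E] (g : ℝ≥0 → E)
    (h : ℝ≥0 → ℝ) (n : ℕ) (t : ℕ → ℝ≥0) : E :=
  ∑ i ∈ Finset.range n, (h (t (i + 1)) - h (t i)) • g (t i)

/-- A sequence of partitions of `[a, b]` that eventually contain each given point of `D`. -/
structure IsExhaustingPartitions (a b : ℝ≥0) (D : Set ℝ≥0) (n : ℕ → ℕ) (t : ℕ → ℕ → ℝ≥0) :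
    Prop where
  isPartition : ∀ k, IsPartition a b (n k) (t k)
  eventually_mem : ∀ x ∈ D, ∀ᶠ k in atTop, ∃ i ≤ n k, t k i = x

/-- The step function on the range of the nondecreasing function `h` that takes the value `g (t i)`
on `(h (t i), h (t (i + 1))]`; its Lebesgue integral is the Stieltjes sum. -/
noncomputable def stieltjesStep {E : Type*} [AddCommGroup E] (g : ℝ≥0 → E) (h : ℝ≥0 → ℝ) (n : ℕ)
    (t : ℕ → ℝ≥0) (u : ℝ) : E :=
  ∑ i ∈ Finset.range n, (Ioc (h (t i)) (h (t (i + 1)))).indicator (fun _ => g (t i)) u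

lemma IsPartition.mem_Icc {a b : ℝ≥0} {n : ℕ} {t : ℕ → ℝ≥0} (ht : IsPartition a b n t) {i : ℕ}
    (hi : i ≤ n) : t i ∈ Icc a b :=
  ⟨ht.left ▸ ht.monotone i.zero_le, ht.right ▸ ht.monotone hi⟩

lemma exists_isPartition_of_finset {a b : ℝ≥0} (hab : a ≤ b) (F : Finset ℝ≥0)
    (hF : ∀ x ∈ F, x ∈ Icc a b) :
    ∃ (n : ℕ) (t : ℕ → ℝ≥0), IsPartition a b n t ∧ ∀ x ∈ F, ∃ i ≤ n, t i = x := by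
  classical
  set G : Finset ℝ≥0 := insert a (insert b F) with hG
  have hGI : ∀ x ∈ G, x ∈ Icc a b := by
    intro x hx
    simp only [hG, Finset.mem_insert] at hx
    rcases hx with rfl | rfl | hx
    · exact ⟨le_rfl, hab⟩
    · exact ⟨hab, le_rfl⟩
    · exact hF x hx
  have hpos : 0 < G.card := Finset.card_pos.2 ⟨a, by simp [hG]⟩
  have hlt (i : ℕ) : min i (G.card - 1) < G.card := by omega
  refine ⟨G.card - 1, fun i => G.orderEmbOfFin rfl ⟨min i (G.card - 1), hlt i⟩,
    ⟨fun i j hij => (G.orderEmbOfFin rfl).monotone ?_, ?_, ?_⟩, fun x hx => ?_⟩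
  · exact Fin.mk_le_mk.2 (min_le_min_right _ hij)
  · simp only [Nat.zero_min]
    rw [Finset.orderEmbOfFin_zero rfl hpos]
    exact le_antisymm (Finset.min'_le _ _ (by simp [hG]))
      (Finset.le_min' _ _ _ fun x hx => (hGI x hx).1)
  · simp only [min_self]
    rw [Finset.orderEmbOfFin_last rfl hpos]
    exact le_antisymm (Finset.max'_le _ _ _ fun x hx => (hGI x hx).2)
      (Finset.le_max' _ _ (by simp [hG]))
  · have hxr : x ∈ range (G.orderEmbOfFin rfl) := by
      rw [Finset.range_orderEmbOfFin]
      simp [hG, hx]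
    obtain ⟨i, rfl⟩ := hxr
    have hi := Nat.le_sub_one_of_lt i.2
    refine ⟨i, hi, ?_⟩
    simp only [min_eq_left hi]

section MonotoneIntegrator

variable {E : Type*} [NormedAddCommGroup E] {a b : ℝ≥0} {n : ℕ} {t : ℕ → ℝ≥0} {h : ℝ≥0 → ℝ}
  {g : ℝ≥0 → E}

lemma stieltjesStep_eq (hh : MonotoneOn h (Icc a b)) (ht : IsPartition a b n t) {i : ℕ}
    (hi : i < n) {u : ℝ} (hu : u ∈ Ioc (h (t i)) (h (t (i + 1)))) :
    stieltjesStep g h n t u = g (t i) := by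
  rw [stieltjesStep, Finset.sum_eq_single i, indicator_of_mem hu]
  · intro j hj hji
    rw [Finset.mem_range] at hj
    refine indicator_of_notMem (fun hu' => ?_) _
    rcases lt_or_gt_of_ne hji with hlt | hlt
    · exact absurd (hh (ht.mem_Icc hj) (ht.mem_Icc hi.le) (ht.monotone hlt))
        (not_le.2 (hu.1.trans_le hu'.2))
    · exact absurd (hh (ht.mem_Icc hi) (ht.mem_Icc hj.le) (ht.monotone hlt))
        (not_le.2 (hu'.1.trans_le hu.2))
  · intro hi'
    exact absurd (Finset.mem_range.2 hi) hi'

lemma stieltjesStep_eq_zero (hh : MonotoneOn h (Icc a b)) (ht : IsPartition a b n t) {u : ℝ}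
    (hu : u ∉ Ioc (h a) (h b)) : stieltjesStep g h n t u = 0 := by
  refine Finset.sum_eq_zero fun i hi => indicator_of_notMem (fun hu' => hu ⟨?_, ?_⟩) _
  · rw [Finset.mem_range] at hi
    have := ht.mem_Icc hi.le
    exact (hh ⟨le_rfl, this.1.trans this.2⟩ this this.1).trans_lt hu'.1
  · rw [Finset.mem_range] at hi
    have := ht.mem_Icc hi
    exact hu'.2.trans (hh this ⟨this.1.trans this.2, le_rfl⟩ this.2)

lemma exists_index_of_mem_Ioc (ht : IsPartition a b n t) {u : ℝ}
    (hu : u ∈ Ioc (h a) (h b)) : ∃ i < n, u ∈ Ioc (h (t i)) (h (t (i + 1))) := by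
  classical
  have hex : ∃ m, u ≤ h (t m) := ⟨n, by rw [ht.right]; exact hu.2⟩
  have hne : Nat.find hex ≠ 0 := by
    intro h0
    have := Nat.find_spec hex
    rw [h0, ht.left] at this
    exact absurd hu.1 (not_lt.2 this)
  obtain ⟨i, hi⟩ := Nat.exists_eq_succ_of_ne_zero hne
  have hle : Nat.find hex ≤ n := Nat.find_min' hex (by rw [ht.right]; exact hu.2)
  refine ⟨i, by omega, not_le.1 (Nat.find_min hex (by omega)), ?_⟩
  have := Nat.find_spec hex
  rwa [hi] at this

/-- Along exhausting partitions the step functions converge pointwise. With `τ` the generalized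
inverse of `h` at `u`, the limit is `g τ` if `h` jumps over `u` to the right of `τ`, and the left
limit of `g` at `τ` otherwise. -/
lemma exists_tendsto_stieltjesStep (hab : a ≤ b) (hh : MonotoneOn h (Icc a b)) {D : Set ℝ≥0}
    (hDd : ∀ s τ, a ≤ s → s < τ → τ ≤ b → ∃ x ∈ D, x ∈ Ioo s τ)
    (hDc : ∀ x ∈ Icc a b, ¬ContinuousWithinAt h (Icc a b) x → x ∈ D)
    (hg : ∀ τ ∈ Ioc a b, ∃ l, Tendsto g (𝓝[<] τ) (𝓝 l)) (u : ℝ) :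
    ∃ l : E, ∀ (n : ℕ → ℕ) (t : ℕ → ℕ → ℝ≥0), IsExhaustingPartitions a b D n t →
      Tendsto (fun k => stieltjesStep g h (n k) (t k) u) atTop (𝓝 l) := by
  by_cases hu : u ∉ Ioc (h a) (h b)
  · exact ⟨0, fun n t ht => by
      simp only [stieltjesStep_eq_zero hh (ht.isPartition _) hu, tendsto_const_nhds_iff]⟩
  rw [not_not] at hu
  set A : Set ℝ≥0 := {x | x ∈ Icc a b ∧ h x < u} with hA
  have haA : a ∈ A := ⟨⟨le_rfl, hab⟩, hu.1⟩
  have hAb : BddAbove A := ⟨b, fun x hx => hx.1.2⟩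
  set τ := sSup A with hτ
  have hτI : τ ∈ Icc a b := ⟨le_csSup hAb haA, csSup_le ⟨a, haA⟩ fun x hx => hx.1.2⟩
  -- a partition point at which `h` stays below `u` lies to the left of the active interval
  have hidx {n : ℕ} {t : ℕ → ℝ≥0} (ht : IsPartition a b n t) {i j : ℕ} (hi : i ≤ n) (hj : j < n)
      (hju : u ∈ Ioc (h (t j)) (h (t (j + 1)))) (hiu : h (t i) < u) : t i ≤ t j := by
    by_contra hlt
    have hij : j + 1 ≤ i := by
      by_contra hij
      exact hlt (ht.monotone (by omega))
    exact absurd (hh (ht.mem_Icc hj) (ht.mem_Icc hi) (ht.monotone hij))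
      (not_le.2 (hiu.trans_le hju.2))
  by_cases hτA : h τ < u
  · have hτb : τ < b := by
      refine lt_of_le_of_ne hτI.2 fun hb => ?_
      rw [hb] at hτA
      exact absurd hu.2 (not_le.2 hτA)
    have hτD : τ ∈ D := by
      refine hDc τ hτI fun hc => ?_
      have h1 : ∀ᶠ x in 𝓝[>] τ, h x < u :=
        (hc.mono_left (nhdsWithin_le_of_mem (Icc_mem_nhdsGT_of_mem ⟨hτI.1, hτb⟩))).eventually
          (gt_mem_nhds hτA)
      have h2 : ∀ᶠ x in 𝓝[>] τ, x ∈ Ioc τ b := Ioc_mem_nhdsGT hτb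
      obtain ⟨x, hx1, hx2⟩ := (h1.and h2).exists
      exact absurd (le_csSup hAb (show x ∈ A from ⟨⟨hτI.1.trans hx2.1.le, hx2.2⟩, hx1⟩))
        (not_le.2 hx2.1)
    refine ⟨g τ, fun n t ht => tendsto_const_nhds.congr' ?_⟩
    filter_upwards [ht.eventually_mem τ hτD] with k ⟨i, hi, hiτ⟩
    have hp := ht.isPartition k
    obtain ⟨j, hj, hju⟩ := exists_index_of_mem_Ioc hp hu
    rw [stieltjesStep_eq hh hp hj hju]
    have h1 := hidx hp hi hj hju (by rwa [hiτ])
    have h2 : t k j ≤ τ := le_csSup hAb ⟨hp.mem_Icc hj.le, hju.1⟩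
    rw [hiτ] at h1
    rw [le_antisymm h1 h2]
  · have haτ : a < τ := by
      refine lt_of_le_of_ne hτI.1 fun ha => hτA ?_
      rw [← ha]
      exact hu.1
    obtain ⟨l, hl⟩ := hg τ ⟨haτ, hτI.2⟩
    refine ⟨l, fun n t ht => ?_⟩
    choose j hj hju using fun k => exists_index_of_mem_Ioc (ht.isPartition k) hu
    have hjA (k : ℕ) : t k (j k) ∈ A := ⟨(ht.isPartition k).mem_Icc (hj k).le, (hju k).1⟩
    have hlt (k : ℕ) : t k (j k) < τ := by
      refine lt_of_le_of_ne (le_csSup hAb (hjA k)) fun heq => hτA ?_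
      rw [← heq]
      exact (hjA k).2
    have hlim : Tendsto (fun k => t k (j k)) atTop (𝓝[<] τ) := by
      refine tendsto_nhdsWithin_iff.2 ⟨?_, Eventually.of_forall hlt⟩
      refine tendsto_order.2 ⟨fun s hs => ?_, fun s hs =>
        Eventually.of_forall fun k => (hlt k).trans hs⟩
      obtain ⟨x, hxD, hx⟩ := hDd (max a s) τ (le_max_left _ _) (max_lt haτ hs) hτI.2
      have hxu : h x < u := by
        obtain ⟨y, hyA, hxy⟩ := exists_lt_of_lt_csSup ⟨a, haA⟩ hx.2
        exact (hh ⟨(le_max_left _ _).trans hx.1.le, hx.2.le.trans hτI.2⟩ hyA.1 hxy.le).trans_lt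
          hyA.2
      filter_upwards [ht.eventually_mem x hxD] with k ⟨i, hi, hix⟩
      have h1 := hidx (ht.isPartition k) hi (hj k) (hju k) (by rwa [hix])
      rw [hix] at h1
      exact ((le_max_right _ _).trans_lt hx.1).trans_le h1
    refine (hl.comp hlim).congr fun k => ?_
    rw [stieltjesStep_eq hh (ht.isPartition k) (hj k) (hju k)]
    rfl

variable [NormedSpace ℝ E]

lemma integral_stieltjesStep [CompleteSpace E] (hh : MonotoneOn h (Icc a b))
    (ht : IsPartition a b n t) :
    ∫ u, stieltjesStep g h n t u = stieltjesSum g h n t := by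
  unfold stieltjesStep stieltjesSum
  rw [integral_finsetSum]
  · refine Finset.sum_congr rfl fun i hi => ?_
    rw [Finset.mem_range] at hi
    rw [integral_indicator_const _ measurableSet_Ioc, Real.volume_real_Ioc_of_le
      (hh (ht.mem_Icc hi.le) (ht.mem_Icc hi) (ht.monotone i.le_succ))]
  · intro i _
    exact (integrable_indicator_iff measurableSet_Ioc).2 (integrableOn_const (by simp))

/-- Dominated convergence for the step functions. -/
lemma exists_tendsto_stieltjesSum_of_monotoneOn [CompleteSpace E] (hab : a ≤ b)
    (hh : MonotoneOn h (Icc a b)) {D : Set ℝ≥0}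
    (hDd : ∀ s τ, a ≤ s → s < τ → τ ≤ b → ∃ x ∈ D, x ∈ Ioo s τ)
    (hDc : ∀ x ∈ Icc a b, ¬ContinuousWithinAt h (Icc a b) x → x ∈ D)
    (hg : ∀ τ ∈ Ioc a b, ∃ l, Tendsto g (𝓝[<] τ) (𝓝 l)) {M : ℝ}
    (hM : ∀ x ∈ Icc a b, ‖g x‖ ≤ M) :
    ∃ J : E, ∀ (n : ℕ → ℕ) (t : ℕ → ℕ → ℝ≥0), IsExhaustingPartitions a b D n t →
      Tendsto (fun k => stieltjesSum g h (n k) (t k)) atTop (𝓝 J) := by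
  choose G hG using exists_tendsto_stieltjesStep hab hh hDd hDc hg
  refine ⟨∫ u, G u, fun n t ht => ?_⟩
  simp only [← integral_stieltjesStep hh (ht.isPartition _)]
  refine tendsto_integral_of_dominated_convergence ((Ioc (h a) (h b)).indicator fun _ => M)
    (fun k => ?_) ?_ (fun k => ae_of_all _ fun u => ?_) (ae_of_all _ fun u => hG u n t ht)
  · refine Finset.aestronglyMeasurable_fun_sum _ fun i _ => ?_
    exact aestronglyMeasurable_const.indicator measurableSet_Ioc
  · exact (integrable_indicator_iff measurableSet_Ioc).2 (integrableOn_const (by simp))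
  · have hp := ht.isPartition k
    by_cases hu : u ∈ Ioc (h a) (h b)
    · obtain ⟨j, hj, hju⟩ := exists_index_of_mem_Ioc hp hu
      rw [indicator_of_mem hu, stieltjesStep_eq hh hp hj hju]
      exact hM _ (hp.mem_Icc hj.le)
    · rw [indicator_of_notMem hu, stieltjesStep_eq_zero hh hp hu, norm_zero]

end MonotoneIntegrator

/-- The Stieltjes integral of a bounded function with left limits against a function of bounded
variation exists, and is the limit of the sums along one sequence of partitions that does not depend
on the integrand. -/
lemma exists_partitions_tendsto_stieltjesIntegral {a b : ℝ≥0} (hab : a < b) {h : ℝ≥0 → ℝ}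
    (hh : BoundedVariationOn h (Icc a b)) :
    ∃ (n : ℕ → ℕ) (t : ℕ → ℕ → ℝ≥0), (∀ k, IsPartition a b (n k) (t k)) ∧
      ∀ (d : ℕ) (g : ℝ≥0 → Rd d),
      (∀ τ ∈ Ioc a b, ∃ l, Tendsto g (𝓝[<] τ) (𝓝 l)) → (∃ M : ℝ, ∀ x ∈ Icc a b, ‖g x‖ ≤ M) →
      ∃ J : Rd d, HasStieltjesIntegral g h a b J ∧
        Tendsto (fun k => stieltjesSum g h (n k) (t k)) atTop (𝓝 J) := by
  classical
  obtain ⟨p, q, hp, hq, rfl⟩ :=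
    hh.locallyBoundedVariationOn.exists_monotoneOn_sub_monotoneOn
  obtain ⟨C, hCc, hCd⟩ := TopologicalSpace.exists_countable_dense ℝ≥0
  set D : Set ℝ≥0 := ((C ∩ Icc a b) ∪ {x ∈ Icc a b | ¬ContinuousWithinAt p (Icc a b) x})
    ∪ {x ∈ Icc a b | ¬ContinuousWithinAt q (Icc a b) x} with hD
  have hDI : ∀ x ∈ D, x ∈ Icc a b := by
    rintro x ((hx | hx) | hx)
    · exact hx.2
    · exact hx.1
    · exact hx.1
  have hDcount : D.Countable :=
    ((hCc.mono inter_subset_left).union hp.countable_not_continuousWithinAt).union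
      hq.countable_not_continuousWithinAt
  have hDd : ∀ s τ, a ≤ s → s < τ → τ ≤ b → ∃ x ∈ D, x ∈ Ioo s τ := by
    intro s τ hs hsτ hτ
    obtain ⟨x, hx, hxC⟩ := hCd.exists_between hsτ
    exact ⟨x, .inl (.inl ⟨hx, ⟨hs.trans hxC.1.le, hxC.2.le.trans hτ⟩⟩), hxC⟩
  obtain ⟨x₀, hx₀, -⟩ := hDd a b le_rfl hab le_rfl
  obtain ⟨e, he⟩ := hDcount.exists_eq_range ⟨x₀, hx₀⟩
  have hF (k : ℕ) : ∀ x ∈ (Finset.range (k + 1)).image e, x ∈ Icc a b := by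
    intro x hx
    obtain ⟨i, -, rfl⟩ := Finset.mem_image.1 hx
    exact hDI _ (he ▸ mem_range_self i)
  have hexh {n : ℕ → ℕ} {t : ℕ → ℕ → ℝ≥0} (hpart : ∀ k, IsPartition a b (n k) (t k))
      (hmem : ∀ k, ∀ x ∈ (Finset.range (k + 1)).image e, ∃ i ≤ n k, t k i = x) :
      IsExhaustingPartitions a b D n t := by
    refine ⟨hpart, fun x hx => ?_⟩
    rw [he] at hx
    obtain ⟨m, rfl⟩ := hx
    filter_upwards [eventually_ge_atTop m] with k hk
    exact hmem k _ (Finset.mem_image_of_mem _ (Finset.mem_range.2 (by omega)))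
  choose n t hpart hmem using fun k => exists_isPartition_of_finset hab.le _ (hF k)
  refine ⟨n, t, hpart, fun d g hg ⟨M, hM⟩ => ?_⟩
  obtain ⟨Jp, hJp⟩ := exists_tendsto_stieltjesSum_of_monotoneOn hab.le hp hDd
    (fun x hx hc => .inl (.inr ⟨hx, hc⟩)) hg hM
  obtain ⟨Jq, hJq⟩ := exists_tendsto_stieltjesSum_of_monotoneOn hab.le hq hDd
    (fun x hx hc => .inr ⟨hx, hc⟩) hg hM
  have hJ (n : ℕ → ℕ) (t : ℕ → ℕ → ℝ≥0) (ht : IsExhaustingPartitions a b D n t) :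
      Tendsto (fun k => stieltjesSum g (p - q) (n k) (t k)) atTop (𝓝 (Jp - Jq)) := by
    refine ((hJp n t ht).sub (hJq n t ht)).congr fun k => ?_
    simp only [stieltjesSum, ← Finset.sum_sub_distrib, ← sub_smul, Pi.sub_apply]
    exact Finset.sum_congr rfl fun i _ => by congr 1; ring
  refine ⟨Jp - Jq, fun ε hε => ?_, hJ n t (hexh hpart hmem)⟩
  -- if the net did not converge, bad partitions could be chosen to exhaust `D`
  by_contra! hcon
  choose m s hs hsa hsb hsF hbad using fun k => hcon _ (hF k)
  have hlim := hJ m s (hexh (fun k => ⟨hs k, hsa k, hsb k⟩) hsF)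
  obtain ⟨k, hk⟩ := ((Metric.tendsto_nhds.1 hlim) ε hε).exists
  rw [dist_eq_norm] at hk
  exact absurd (hbad k) (not_le.2 hk)

/-! ### Time-changed càdlàg paths -/

section Cadlag

variable {E : Type*} [NormedAddCommGroup E] {f : ℝ≥0 → E}

lemma exists_bound_Icc_of_cadlag (hf : ∀ t : ℝ≥0, ContinuousWithinAt f (Ici t) t ∧
    ∃ l, Tendsto f (𝓝[<] t) (𝓝 l)) (R : ℝ≥0) : ∃ M : ℝ, ∀ x ∈ Icc 0 R, ‖f x‖ ≤ M := by
  refine isCompact_Icc.induction_on (p := fun S => ∃ M : ℝ, ∀ x ∈ S, ‖f x‖ ≤ M) ⟨0, by simp⟩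
    (fun S T hST ⟨M, hM⟩ => ⟨M, fun x hx => hM x (hST hx)⟩) ?_ fun x _ => ?_
  · rintro S T ⟨M, hM⟩ ⟨N, hN⟩
    refine ⟨max M N, fun x hx => ?_⟩
    rcases hx with hx | hx
    · exact (hM x hx).trans (le_max_left _ _)
    · exact (hN x hx).trans (le_max_right _ _)
  · obtain ⟨hr, l, hl⟩ := hf x
    have h1 : ∀ᶠ y in 𝓝[<] x, ‖f y‖ ≤ max (‖l‖ + 1) (‖f x‖ + 1) := by
      filter_upwards [hl.norm.eventually (gt_mem_nhds (lt_add_one ‖l‖))] with y hy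
      exact hy.le.trans (le_max_left _ _)
    have h2 : ∀ᶠ y in 𝓝[≥] x, ‖f y‖ ≤ max (‖l‖ + 1) (‖f x‖ + 1) := by
      filter_upwards [hr.norm.eventually (gt_mem_nhds (lt_add_one ‖f x‖))] with y hy
      exact hy.le.trans (le_max_right _ _)
    have h3 : ∀ᶠ y in 𝓝 x, ‖f y‖ ≤ max (‖l‖ + 1) (‖f x‖ + 1) := by
      rw [← nhdsLT_sup_nhdsGE, eventually_sup]
      exact ⟨h1, h2⟩
    exact ⟨_, mem_nhdsWithin_of_mem_nhds h3, _, fun y hy => hy⟩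

/-- If `r` increases to its left limit `L` without attaining it, then `f ∘ r` has the left limit
of `f` at `L` as left limit; in all other cases it has `f L`, by right-continuity of `f`. -/
lemma exists_leftLim_comp_of_cadlag (hf : ∀ t : ℝ≥0, ContinuousWithinAt f (Ici t) t ∧
    ∃ l, Tendsto f (𝓝[<] t) (𝓝 l)) {r : ℝ≥0 → ℝ≥0} {c τ : ℝ≥0} (hcτ : c < τ)
    (hb : BddAbove (r '' Ioo c τ)) (hr : MonotoneOn r (Ioo c τ) ∨ AntitoneOn r (Ioo c τ)) :
    ∃ l, Tendsto (fun t => f (r t)) (𝓝[<] τ) (𝓝 l) := by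
  have hne : (Ioo c τ).Nonempty := nonempty_Ioo.2 hcτ
  rcases hr with hr | hr
  · have hlim := hr.tendsto_nhdsWithin_Ioo_left hne hb
    set L := sSup (r '' Ioo c τ)
    have hle : ∀ s ∈ Ioo c τ, r s ≤ L := fun s hs => le_csSup hb (mem_image_of_mem r hs)
    by_cases hatt : ∃ s ∈ Ioo c τ, r s = L
    · obtain ⟨s, hs, hsL⟩ := hatt
      refine ⟨f L, tendsto_const_nhds.congr' ?_⟩
      filter_upwards [Ioo_mem_nhdsLT hs.2] with x hx
      have hx' : x ∈ Ioo c τ := ⟨hs.1.trans hx.1, hx.2⟩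
      rw [le_antisymm (hle x hx') (hsL ▸ hr hs hx' hx.1.le)]
    · push Not at hatt
      obtain ⟨l, hl⟩ := (hf L).2
      refine ⟨l, hl.comp (tendsto_nhdsWithin_iff.2 ⟨hlim, ?_⟩)⟩
      filter_upwards [Ioo_mem_nhdsLT hcτ] with x hx
      exact lt_of_le_of_ne (hle x hx) (hatt x hx)
  · have hlim := hr.tendsto_nhdsWithin_Ioo_left hne (OrderBot.bddBelow (r '' Ioo c τ))
    set L := sInf (r '' Ioo c τ)
    refine ⟨f L, (hf L).1.tendsto.comp (tendsto_nhdsWithin_iff.2 ⟨hlim, ?_⟩)⟩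
    filter_upwards [Ioo_mem_nhdsLT hcτ] with x hx
    exact csInf_le (OrderBot.bddBelow _) (mem_image_of_mem r hx)

lemma PiecewiseMonotoneOn.exists_leftLim_comp {r : ℝ≥0 → ℝ≥0} {a b : ℝ≥0}
    (hr : PiecewiseMonotoneOn r a b) (hf : ∀ t : ℝ≥0, ContinuousWithinAt f (Ici t) t ∧
      ∃ l, Tendsto f (𝓝[<] t) (𝓝 l)) {τ : ℝ≥0} (hτ : τ ∈ Ioc a b) :
    ∃ l, Tendsto (fun t => f (r t)) (𝓝[<] τ) (𝓝 l) := by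
  obtain ⟨hb, n, t, htm, hta, htb, hmono⟩ := hr
  have hp : IsPartition a b n t := ⟨htm, hta, htb⟩
  obtain ⟨i, hi, hi1, hi2⟩ := exists_index_of_mem_Ioc hp (h := fun x => (x : ℝ)) (u := τ)
    ⟨NNReal.coe_lt_coe.2 hτ.1, NNReal.coe_le_coe.2 hτ.2⟩
  rw [NNReal.coe_lt_coe] at hi1
  rw [NNReal.coe_le_coe] at hi2
  have hsub : Ioo (t i) τ ⊆ Ioo (t i) (t (i + 1)) := Ioo_subset_Ioo_right hi2
  refine exists_leftLim_comp_of_cadlag hf hi1 (hb.mono (image_mono fun x hx => ?_))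
    ((hmono i hi).imp (fun h => h.mono hsub) fun h => h.mono hsub)
  exact ⟨(hp.mem_Icc hi.le).1.trans hx.1.le, hx.2.le.trans hτ.2⟩

end Cadlag

/-! ### The random integral -/

/-- The approximation of the random integral by the Stieltjes sum over a partition. -/
noncomputable def integralApprox {d : ℕ} {Ω : Type} (h : ℝ≥0 → ℝ) (r : ℝ≥0 → ℝ≥0) (a b : ℝ≥0)
    (Y : ℝ≥0 → Ω → Rd d) (n : ℕ) (t : ℕ → ℝ≥0) (ω : Ω) : Rd d :=
  h b • Y (r b) ω - h a • Y (r a) ω - stieltjesSum (fun s => Y (r s) ω) h n t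

namespace IsLevyProcess

variable {d : ℕ} {Ω Ω' : Type} [MeasurableSpace Ω] [MeasurableSpace Ω'] {P : Measure Ω}
  {P' : Measure Ω'} {Y : ℝ≥0 → Ω → Rd d} {Y' : ℝ≥0 → Ω' → Rd d} {h : ℝ≥0 → ℝ} {r : ℝ≥0 → ℝ≥0}
  {a b : ℝ≥0}

lemma measurable_integralApprox (hY : IsLevyProcess Y P) (n : ℕ) (t : ℕ → ℝ≥0) :
    Measurable (integralApprox h r a b Y n t) := by
  have hm (s : ℝ≥0) := hY.measurable s
  unfold integralApprox stieltjesSum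
  fun_prop

lemma map_integralApprox_eq [IsProbabilityMeasure P] [IsProbabilityMeasure P']
    (hY : IsLevyProcess Y P) (hY' : IsLevyProcess Y' P')
    (hne : ∀ y, charFun (P.map (Y 1)) y ≠ 0) (h1 : P.map (Y 1) = P'.map (Y' 1))
    {n : ℕ} {t : ℕ → ℝ≥0} (ht : IsPartition a b n t) :
    P.map (integralApprox h r a b Y n t) = P'.map (integralApprox h r a b Y' n t) := by
  have hm (s : ℝ≥0) := hY.measurable s
  have hm' (s : ℝ≥0) := hY'.measurable s
  set B : (Fin (n + 1) → Rd d) → Rd d := fun x => h b • x (Fin.last n) - h a • x 0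
    - ∑ i : Fin n, (h (t (i + 1)) - h (t i)) • x i.castSucc with hB
  have hBm : Measurable B := by fun_prop
  have hBY {Ω₀ : Type} (Z : ℝ≥0 → Ω₀ → Rd d) :
      integralApprox h r a b Z n t = B ∘ fun ω (i : Fin (n + 1)) => Z (r (t i)) ω := by
    funext ω
    simp [integralApprox, stieltjesSum, hB, ht.left, ht.right, Finset.sum_range]
  rw [hBY, hBY, ← Measure.map_map hBm (by fun_prop), ← Measure.map_map hBm (by fun_prop),
    hY.map_finite_times_eq hY' hne h1]

/-- The random integral exists for every Lévy process, as the almost sure limit of the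
approximations along deterministic partitions; the latter makes it measurable. -/
lemma exists_isRandomIntegral [IsProbabilityMeasure P] (hY : IsLevyProcess Y P)
    (hr : PiecewiseMonotoneOn r a b)
    {n : ℕ → ℕ} {t : ℕ → ℕ → ℝ≥0}
    (hint : ∀ g : ℝ≥0 → Rd d,
      (∀ τ ∈ Ioc a b, ∃ l, Tendsto g (𝓝[<] τ) (𝓝 l)) → (∃ M : ℝ, ∀ x ∈ Icc a b, ‖g x‖ ≤ M) →
      ∃ J : Rd d, HasStieltjesIntegral g h a b J ∧
        Tendsto (fun k => stieltjesSum g h (n k) (t k)) atTop (𝓝 J)) :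
    ∃ X : Ω → Rd d, IsRandomIntegral h r a b Y P X ∧
      ∀ᵐ ω ∂P, Tendsto (fun k => integralApprox h r a b Y (n k) (t k) ω) atTop (𝓝 (X ω)) := by
  have hpath : ∀ᵐ ω ∂P, ∃ J : Rd d, HasStieltjesIntegral (fun s => Y (r s) ω) h a b J ∧
      Tendsto (fun k => stieltjesSum (fun s => Y (r s) ω) h (n k) (t k)) atTop (𝓝 J) := by
    filter_upwards [hY.cadlag] with ω hω
    refine hint _ (fun τ hτ => hr.exists_leftLim_comp hω hτ) ?_
    obtain ⟨R, hR⟩ := hr.1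
    obtain ⟨M, hM⟩ := exists_bound_Icc_of_cadlag hω R
    exact ⟨M, fun x hx => hM _ ⟨zero_le, hR (mem_image_of_mem r hx)⟩⟩
  obtain ⟨J, hJ⟩ := hpath.choice
  have hlim : ∀ᵐ ω ∂P, Tendsto (fun k => integralApprox h r a b Y (n k) (t k) ω) atTop
      (𝓝 (h b • Y (r b) ω - h a • Y (r a) ω - J ω)) := by
    filter_upwards [hJ] with ω hω
    exact tendsto_const_nhds.sub hω.2
  refine ⟨fun ω => h b • Y (r b) ω - h a • Y (r a) ω - J ω, ⟨?_, ?_⟩, hlim⟩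
  · exact aemeasurable_of_tendsto_metrizable_ae atTop
      (fun k => (hY.measurable_integralApprox _ _).aemeasurable) hlim
  · filter_upwards [hJ] with ω hω
    exact ⟨J ω, hω.1, rfl⟩

end IsLevyProcess

/-- The random integral mapping is defined at every infinitely divisible measure. -/
lemma exists_isRandomIntegralLaw {d : ℕ} {h : ℝ≥0 → ℝ} {r : ℝ≥0 → ℝ≥0} {a b : ℝ≥0} (hab : a < b)
    (hh : BoundedVariationOn h (Icc a b)) (hr : PiecewiseMonotoneOn r a b)
    {ν : ProbabilityMeasure (Rd d)} (hν : ν ∈ ID d) :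
    ∃ ρ : ProbabilityMeasure (Rd d), IsRandomIntegralLaw h r a b ν ρ := by
  obtain ⟨n, t, ht, hint⟩ := exists_partitions_tendsto_stieltjesIntegral hab hh
  -- `ρ` has to be named before a process is given, so it is read off from one of them; that a Lévy
  -- process with law `ν` at time `1` exists is not needed, as the claim is about all such processes
  by_cases hex : ∃ (Ω : Type) (_ : MeasurableSpace Ω) (P : Measure Ω) (_ : IsProbabilityMeasure P)
      (Y : ℝ≥0 → Ω → Rd d), IsLevyProcess Y P ∧ P.map (Y 1) = (ν : Measure (Rd d))
  · obtain ⟨Ω, _, P, _, Y, hY, hY1⟩ := hex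
    obtain ⟨X, hX, hXlim⟩ := hY.exists_isRandomIntegral hr (hint d)
    have := Measure.isProbabilityMeasure_map hX.1
    refine ⟨⟨P.map X, this⟩, fun Ω' _ P' _ Y' hY' hY1' => ?_⟩
    obtain ⟨X', hX', hXlim'⟩ := hY'.exists_isRandomIntegral hr (hint d)
    refine ⟨X', hX', ?_⟩
    change P'.map X' = P.map X
    have := Measure.isProbabilityMeasure_map hX'.1
    have hne (y : Rd d) : charFun (P'.map (Y' 1)) y ≠ 0 := by
      rw [hY1']
      exact charFun_ne_zero_of_mem_ID hν y
    refine Measure.ext_of_charFun (funext fun y => tendsto_nhds_unique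
      (tendsto_charFun_map_of_ae_tendsto
        (fun k => (hY'.measurable_integralApprox _ _).aemeasurable) hX'.1 hXlim' y) ?_)
    simp only [hY'.map_integralApprox_eq hY hne (hY1'.trans hY1.symm) (ht _)]
    exact tendsto_charFun_map_of_ae_tendsto
      (fun k => (hY.measurable_integralApprox _ _).aemeasurable) hX.1 hXlim y
  · exact ⟨ν, fun Ω _ P _ Y hY hY1 => absurd ⟨Ω, _, P, inferInstance, Y, hY, hY1⟩ hex⟩

lemma randomIntegralDomain_eq_ID (d : ℕ) {h : ℝ≥0 → ℝ} {r : ℝ≥0 → ℝ≥0} {a b : ℝ≥0} (hab : a < b)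
    (hh : BoundedVariationOn h (Icc a b)) (hr : PiecewiseMonotoneOn r a b) :
    randomIntegralDomain d h r a b = ID d :=
  Subset.antisymm (fun _ hν => hν.1) fun _ hν => ⟨hν, exists_isRandomIntegralLaw hab hh hr hν⟩

theorem corollary1 (d : ℕ) (h : ℝ≥0 → ℝ) (r : ℝ≥0 → ℝ≥0) (a b : ℝ≥0) (hab : a < b)
    (hh : BoundedVariationOn h (Icc a b)) (hr : PiecewiseMonotoneOn r a b) :
    IsClosedConvSubsemigroup (randomIntegralDomain d h r a b) := by
  rw [randomIntegralDomain_eq_ID d hab hh hr]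
  exact
    { subset_ID := Subset.rfl
      nonempty := ⟨_, diracZero_mem_ID d⟩
      isClosed := isClosed_ID d
      conv_mem := fun _ hμ _ hν => pconv_mem_ID hμ hν
      dilate_mem := fun u _ hν => dilate_mem_ID u hν
      convPower_mem := fun _ hc _ hν => exists_isConvPower_of_mem_ID hc hν }
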